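/- Let $d\ge 1$, let $[d]=\{1,\dots,d\}$, and let $c(y)=\sum_{1\le i<j\le d}c_{ij}\,y_iy_j$ for $y\in\mathbb R^d$, with $c_{ij}\ge 0$, be such that the graph on $[d]$ having an edge between $i<j$ if and only if $c_{ij}>0$ is connected. Let $\mu=(\mu_i)_{1\le i\le d}$ and $\nu=(\nu_i)_{1\le i\le d}$ be probability measures on $\mathbb R$ with finite second moments. Assume that $(\mu_i,\nu_i)_{1\le i\le d}$ satisfy LIM (linear increment of marginals) with $a=(a_1,\dots,a_d)$, i.e. $a_i>0$ for all $i$ and there is a non-Dirac probability measure $\kappa$ on $\mathbb R$ with finite first moment and $\int z\,\kappa(dz)=0$ such that, for every $i$, $$\nu_i=\mu_i * (a_i)_\#\kappa ,$$ where $(a_i)_\#\kappa$ is the push-forward of $\kappa$ by $z\mapsto a_iz$. Let $\Pi(\mu_1,\dots,\mu_d)$ be the set of probability measures on $\mathbb R^d$ with one-dimensional marginals $\mu_1,\dots,\mu_d$. Let $\mathcal M(\mu,\nu)$ be the set of laws $\pi$ on $\mathbb R^d\times\mathbb R^d$ of pairs $(X,Y)$ of random vectors with $X_i\sim\mu_i$,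 $Y_i\sim\nu_i$ for all $i$ and $\mathbb E[Y\mid X]=X$. An MMOT is a maximizer of $\pi\mapsto\int c(y)\,\pi(dx,dy)$ over $\mathcal M(\mu,\nu)$. For $\pi\in\mathcal M(\mu,\nu)$ let $\pi^1$ denote the law of $X$ under $\pi$, and let $L=\mathrm{span}(a)\subset\mathbb R^d$. Then every MMOT $\pi$, for every disintegration $\pi(dx,dy)=\pi_x(dy)\,\pi^1(dx)$ with probability kernels $\pi_x$, satisfies: 1. $\operatorname{supp}\pi_x\subset x+L$ for $\pi^1$-almost every $x$; 2. $\pi^1$ maximizes $\gamma\mapsto\int c(x)\,\gamma(dx)$ over $\Pi(\mu_1,\dots,\mu_d)$. Moreover, if $d=2$ or $d=3$ and the first marginals are atomless, i.e. $\mu_i(\{x\})=0$ for all $x\in\mathbb R$ and $i\in[d]$, then $\pi^1$ is the same for all MMOTs: if $\pi$ and $\tilde\pi$ are MMOTs, then $\pi^1=\tilde\pi^1$. -/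

import Mathlib

open MeasureTheory ProbabilityTheory

namespace CovMMOT

variable {d : ℕ}

/-- The covariance functional `c(y) = ∑_{i<j} c_ij y_i y_j`. Only the entries `c i j` with `i < j`
are used. -/
def cost (c : Fin d → Fin d → ℝ) (y : Fin d → ℝ) : ℝ :=
  ∑ i, ∑ j ∈ Finset.Ioi i, c i j * y i * y j

/-- The graph on `[d]` in which `i < j` are joined by an undirected edge iff `c_ij > 0`. -/
def costGraph (c : Fin d → Fin d → ℝ) : SimpleGraph (Fin d) :=
  SimpleGraph.fromRel fun i j => i < j ∧ 0 < c i j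

/-- Linear Increment of Marginals with scaling vector `a`: the `a_i` are positive and, for one
centered non-Dirac probability measure `κ` on `ℝ`, `ν_i = μ_i * (a_i)_# κ` for every `i`. -/
def LIM (μ ν : Fin d → Measure ℝ) (a : Fin d → ℝ) : Prop :=
  (∀ i, 0 < a i) ∧
    ∃ κ : Measure ℝ, IsProbabilityMeasure κ ∧ Integrable (fun z => z) κ ∧ ∫ z, z ∂κ = 0 ∧
      (∀ z, κ ≠ Measure.dirac z) ∧
      ∀ i, ν i = (μ i).conv (κ.map fun z => a i * z)

/-- `γ ∈ Π(μ_1, …, μ_d)`: a probability measure on `ℝ^d` with finite first moment and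
one-dimensional marginals `μ_i`. -/
structure IsTransport (μ : Fin d → Measure ℝ) (γ : Measure (Fin d → ℝ)) : Prop where
  prob : IsProbabilityMeasure γ
  integrable : Integrable (fun x => x) γ
  marginal : ∀ i, γ.map (fun x => x i) = μ i

/-- `γ` is an optimal transport plan for the maximization of `∫ c(x) γ(dx)` over
`Π(μ_1, …, μ_d)`. -/
def IsOptimalTransport (c : Fin d → Fin d → ℝ) (μ : Fin d → Measure ℝ)
    (γ : Measure (Fin d → ℝ)) : Prop :=
  IsTransport μ γ ∧ ∀ γ', IsTransport μ γ' → ∫ x, cost c x ∂γ' ≤ ∫ x, cost c x ∂γ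

/-- `π ∈ 𝓜(μ, ν)`: the law of a pair `(X, Y)` of integrable random vectors in `ℝ^d` with
`X_i ∼ μ_i`, `Y_i ∼ ν_i` for every `i` and `E[Y | X] = X`. -/
structure IsMartingaleTransport (μ ν : Fin d → Measure ℝ)
    (π : Measure ((Fin d → ℝ) × (Fin d → ℝ))) : Prop where
  prob : IsProbabilityMeasure π
  integrable : Integrable (fun p => p) π
  marginal_fst : ∀ i, π.map (fun p => p.1 i) = μ i
  marginal_snd : ∀ i, π.map (fun p => p.2 i) = ν i
  martingale : π[fun p => p.2 | MeasurableSpace.comap Prod.fst inferInstance] =ᵐ[π] fun p => p.1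

/-- `π` is an MMOT: a maximizer of `∫ c(y) π(dx, dy)` over `𝓜(μ, ν)`. -/
def IsMMOT (c : Fin d → Fin d → ℝ) (μ ν : Fin d → Measure ℝ)
    (π : Measure ((Fin d → ℝ) × (Fin d → ℝ))) : Prop :=
  IsMartingaleTransport μ ν π ∧
    ∀ π', IsMartingaleTransport μ ν π' → ∫ p, cost c p.2 ∂π' ≤ ∫ p, cost c p.2 ∂π

end CovMMOT

namespace CovMMOT

variable {d : ℕ}

/-! The martingale property gives `E[(Y_i - X_i)(Y_j - X_j)] = E[Y_i Y_j] - E[X_i X_j]`. Expanding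
the square in `incrementGap` therefore splits the value of any martingale transport into the value
of its first law, a constant depending on the marginals, and minus a nonnegative combination of gaps
(`IsMartingaleTransport.integral_cost_snd`). Under LIM the penalty can be removed without changing
the first law: adding independent noise `Z a`, `Z ∼ κ`, is admissible and has zero gaps. Hence an
MMOT has an optimal first law and zero gap along every edge. Connectedness then makes all rescaled
increments equal, so `Y - X` lies in the span of `a`.

For uniqueness, the quantile coupling maximizes all mixed moments at once, so an optimal plan
attains the maximum on each edge. By the equality case of Hoeffding's formula
(`AEComonotone.of_integral_mul_le`) the two coordinates are comonotone. Without atoms comonotonicity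
is transitive, hence holds for all pairs, and pairwise comonotonicity together with the marginals
fixes the mass of every upper orthant. -/

/-! ### The linear increment coupling. -/

/-- The law of `(X, X + Z a)` where `X ∼ γ` and `Z ∼ κ` are independent. -/
noncomputable def linearIncrement (a : Fin d → ℝ) (κ : Measure ℝ) (γ : Measure (Fin d → ℝ)) :
    Measure ((Fin d → ℝ) × (Fin d → ℝ)) :=
  (γ.prod κ).map fun q => (q.1, q.1 + q.2 • a)

lemma measurable_linearIncrement (a : Fin d → ℝ) :
    Measurable fun q : (Fin d → ℝ) × ℝ => (q.1, q.1 + q.2 • a) := by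
  fun_prop

lemma linearIncrement_fst (a : Fin d → ℝ) (κ : Measure ℝ) [IsProbabilityMeasure κ]
    (γ : Measure (Fin d → ℝ)) [IsProbabilityMeasure γ] :
    (linearIncrement a κ γ).fst = γ := by
  rw [linearIncrement, Measure.fst, Measure.map_map measurable_fst (measurable_linearIncrement a)]
  exact Measure.fst_prod

lemma isMartingaleTransport_linearIncrement {μ ν : Fin d → Measure ℝ} {a : Fin d → ℝ}
    {κ : Measure ℝ} [IsProbabilityMeasure κ] (hκ : Integrable (fun z => z) κ)
    (hκ0 : ∫ z, z ∂κ = 0) (hν : ∀ i, ν i = (μ i).conv (κ.map fun z => a i * z))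
    {γ : Measure (Fin d → ℝ)} (hγ : IsTransport μ γ) :
    IsMartingaleTransport μ ν (linearIncrement a κ γ) := by
  have := hγ.prob
  have hm := measurable_linearIncrement a
  have hX : Integrable (fun q : (Fin d → ℝ) × ℝ => q.1) (γ.prod κ) := hγ.integrable.comp_fst κ
  have hZ : Integrable (fun q : (Fin d → ℝ) × ℝ => q.2 • a) (γ.prod κ) :=
    (hκ.comp_snd γ).smul_const a
  have hprob : IsProbabilityMeasure (linearIncrement a κ γ) :=
    Measure.isProbabilityMeasure_map hm.aemeasurable
  have hint : Integrable (fun p => p) (linearIncrement a κ γ) :=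
    (integrable_map_measure (by fun_prop) hm.aemeasurable).2 (hX.prodMk (hX.add hZ))
  refine ⟨hprob, hint, fun i => ?_, fun i => ?_, ?_⟩
  · rw [← hγ.marginal i, linearIncrement, Measure.map_map (by fun_prop) hm]
    nth_rw 2 [← Measure.fst_prod (μ := γ) (ν := κ)]
    rw [Measure.fst, Measure.map_map (by fun_prop) (by fun_prop)]
    rfl
  · rw [hν i, ← hγ.marginal i, linearIncrement, Measure.map_map (by fun_prop) hm, Measure.conv,
      Measure.map_prod_map _ _ (by fun_prop) (by fun_prop),
      Measure.map_map (by fun_prop) (by fun_prop)]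
    congr 1
    ext q
    simp [mul_comm]
  · symm
    have hfst : Integrable (fun p => p.1) (linearIncrement a κ γ) := hint.fst
    have hsnd : Integrable (fun p => p.2) (linearIncrement a κ γ) := hint.snd
    refine ae_eq_condExp_of_forall_setIntegral_eq measurable_fst.comap_le hsnd
      (fun _ _ _ => hfst.integrableOn) ?_ ?_
    · rintro _ ⟨t, ht, rfl⟩ -
      have hpre : (fun q : (Fin d → ℝ) × ℝ => (q.1, q.1 + q.2 • a)) ⁻¹' (Prod.fst ⁻¹' t)
          = t ×ˢ Set.univ := by
        ext; simp
      rw [linearIncrement, setIntegral_map (measurable_fst ht) (by fun_prop) hm.aemeasurable,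
        setIntegral_map (measurable_fst ht) (by fun_prop) hm.aemeasurable, hpre,
        integral_add hX.integrableOn hZ.integrableOn, left_eq_add]
      -- By independence the noise integrates over `t ×ˢ univ` to a multiple of the mean of `κ`,
      -- which is zero.
      have := setIntegral_prod_mul (μ := γ) (ν := κ) (fun _ => (1 : ℝ)) (fun z => z) t Set.univ
      rw [integral_smul_const]
      simp only [one_mul, Measure.restrict_univ, hκ0, mul_zero] at this
      rw [this, zero_smul]
    · exact (comap_measurable _).stronglyMeasurable.aestronglyMeasurable

/-! ### Second moments of martingale transports. -/

section Moments

variable {μ ν : Fin d → Measure ℝ} {π : Measure ((Fin d → ℝ) × (Fin d → ℝ))}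

lemma IsTransport.memLp {γ : Measure (Fin d → ℝ)} (h : IsTransport μ γ)
    (hμ : ∀ i, MemLp (fun x : ℝ => x) 2 (μ i)) (i : Fin d) : MemLp (fun x => x i) 2 γ := by
  have := hμ i
  rw [← h.marginal i] at this
  exact (memLp_map_measure_iff measurable_id.aestronglyMeasurable
    (measurable_pi_apply i).aemeasurable).1 this

lemma IsMartingaleTransport.isTransport_fst (h : IsMartingaleTransport μ ν π) :
    IsTransport μ π.fst := by
  have := h.prob
  refine ⟨inferInstance, ?_, fun i => ?_⟩
  · exact (integrable_map_measure (by fun_prop) (by fun_prop)).2 h.integrable.fst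
  · rw [← h.marginal_fst i, Measure.fst, Measure.map_map (by fun_prop) (by fun_prop)]
    rfl

lemma IsMartingaleTransport.memLp_fst (h : IsMartingaleTransport μ ν π)
    (hμ : ∀ i, MemLp (fun x : ℝ => x) 2 (μ i)) (i : Fin d) : MemLp (fun p => p.1 i) 2 π := by
  have := hμ i
  rw [← h.marginal_fst i] at this
  exact (memLp_map_measure_iff (by fun_prop) (by fun_prop)).1 this

lemma IsMartingaleTransport.memLp_snd (h : IsMartingaleTransport μ ν π)
    (hν : ∀ i, MemLp (fun x : ℝ => x) 2 (ν i)) (i : Fin d) : MemLp (fun p => p.2 i) 2 π := by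
  have := hν i
  rw [← h.marginal_snd i] at this
  exact (memLp_map_measure_iff (by fun_prop) (by fun_prop)).1 this

/-- Condition on `X`: the factor `X_i` pulls out, and the coordinate projection commutes with
conditional expectation. -/
lemma IsMartingaleTransport.integral_fst_mul_snd (h : IsMartingaleTransport μ ν π)
    (hμ : ∀ i, MemLp (fun x : ℝ => x) 2 (μ i)) (hν : ∀ i, MemLp (fun x : ℝ => x) 2 (ν i))
    (i j : Fin d) : ∫ p, p.1 i * p.2 j ∂π = ∫ p, p.1 i * p.1 j ∂π := by
  have := h.prob
  set m : MeasurableSpace ((Fin d → ℝ) × (Fin d → ℝ)) := MeasurableSpace.comap Prod.fst inferInstance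
  have hm : m ≤ Prod.instMeasurableSpace := measurable_fst.comap_le
  have hsnd : Integrable (fun p => p.2) π := h.integrable.snd
  have hcoord := (ContinuousLinearMap.proj (R := ℝ) (φ := fun _ : Fin d => ℝ) j).comp_condExp_comm
    (m := m) hsnd
  have hX : StronglyMeasurable[m] fun p : (Fin d → ℝ) × (Fin d → ℝ) => p.1 i :=
    ((measurable_pi_apply i).comp (comap_measurable Prod.fst)).stronglyMeasurable
  have hpull := condExp_mul_of_stronglyMeasurable_left (μ := π) (g := fun p => p.2 j) hX
    ((h.memLp_fst hμ i).integrable_mul (h.memLp_snd hν j)) ((h.memLp_snd hν j).integrable (by simp))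
  change ∫ p, ((fun p : (Fin d → ℝ) × (Fin d → ℝ) => p.1 i) *
    fun p : (Fin d → ℝ) × (Fin d → ℝ) => p.2 j) p ∂π = _
  rw [← integral_condExp hm]
  refine integral_congr_ae ?_
  filter_upwards [hpull, hcoord, h.martingale] with p h1 h2 h3
  rw [h1, Pi.mul_apply]
  congr 1
  refine Eq.trans h2.symm ?_
  simp only [Function.comp_apply]
  rw [h3]
  rfl

lemma IsMartingaleTransport.integral_sq_snd (h : IsMartingaleTransport μ ν π) (i : Fin d) :
    ∫ p, p.2 i * p.2 i ∂π = ∫ y, y * y ∂ν i := by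
  rw [← h.marginal_snd i, integral_map (by fun_prop) (by fun_prop)]

lemma IsMartingaleTransport.integral_sq_fst (h : IsMartingaleTransport μ ν π) (i : Fin d) :
    ∫ p, p.1 i * p.1 i ∂π = ∫ y, y * y ∂μ i := by
  rw [← h.marginal_fst i, integral_map (by fun_prop) (by fun_prop)]

/-- The mean squared discrepancy between the rescaled increments of coordinates `i` and `j`. -/
noncomputable def incrementGap (a : Fin d → ℝ) (π : Measure ((Fin d → ℝ) × (Fin d → ℝ)))
    (i j : Fin d) : ℝ :=
  ∫ p, ((p.2 i - p.1 i) / a i - (p.2 j - p.1 j) / a j) ^ 2 ∂π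

lemma incrementGap_nonneg (a : Fin d → ℝ) (i j : Fin d) : 0 ≤ incrementGap a π i j :=
  integral_nonneg fun _ => sq_nonneg _

/-- Polarization: the gap is a square whose cross term carries `E[Y_i Y_j] - E[X_i X_j]` and whose
diagonal terms are differences of marginal second moments. -/
lemma IsMartingaleTransport.integral_snd_mul_snd (h : IsMartingaleTransport μ ν π)
    (hμ : ∀ i, MemLp (fun x : ℝ => x) 2 (μ i)) (hν : ∀ i, MemLp (fun x : ℝ => x) 2 (ν i))
    {a : Fin d → ℝ} (ha : ∀ i, 0 < a i) (i j : Fin d) :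
    ∫ p, p.2 i * p.2 j ∂π = ∫ p, p.1 i * p.1 j ∂π
      + a i * a j / 2 * ((∫ y, y * y ∂ν i - ∫ y, y * y ∂μ i) / a i ^ 2
        + (∫ y, y * y ∂ν j - ∫ y, y * y ∂μ j) / a j ^ 2) - a i * a j / 2 * incrementGap a π i j := by
  have := h.prob
  have X := h.memLp_fst hμ
  have Y := h.memLp_snd hν
  have xx k l : Integrable (fun p => p.1 k * p.1 l) π := (X k).integrable_mul (X l)
  have xy k l : Integrable (fun p => p.1 k * p.2 l) π := (X k).integrable_mul (Y l)
  have yy k l : Integrable (fun p => p.2 k * p.2 l) π := (Y k).integrable_mul (Y l)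
  have key k l : ∫ p, (p.2 k - p.1 k) * (p.2 l - p.1 l) ∂π
      = ∫ p, p.2 k * p.2 l ∂π - ∫ p, p.1 k * p.1 l ∂π := by
    have e : (fun p : (Fin d → ℝ) × (Fin d → ℝ) => (p.2 k - p.1 k) * (p.2 l - p.1 l))
      = fun p => (p.2 k * p.2 l - p.1 k * p.2 l) - (p.1 l * p.2 k - p.1 k * p.1 l) := by
      ext p; ring
    rw [e, integral_sub (by fun_prop) (by fun_prop),
      integral_sub (yy k l) (xy k l), integral_sub (xy l k) (xx k l),
      h.integral_fst_mul_snd hμ hν, h.integral_fst_mul_snd hμ hν]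
    simp only [mul_comm]
    ring
  have D k : MemLp (fun p => p.2 k - p.1 k) 2 π := (Y k).sub (X k)
  have DD k l : Integrable (fun p => (p.2 k - p.1 k) * (p.2 l - p.1 l)) π :=
    (D k).integrable_mul (D l)
  have gap : incrementGap a π i j = (∫ p, (p.2 i - p.1 i) * (p.2 i - p.1 i) ∂π) / a i ^ 2
      + (∫ p, (p.2 j - p.1 j) * (p.2 j - p.1 j) ∂π) / a j ^ 2
      - 2 / (a i * a j) * ∫ p, (p.2 i - p.1 i) * (p.2 j - p.1 j) ∂π := by
    rw [← integral_div, ← integral_div, ← integral_const_mul,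
      ← integral_add ((DD i i).div_const _) ((DD j j).div_const _),
      ← integral_sub (by fun_prop) (by fun_prop)]
    refine integral_congr_ae (.of_forall fun p => ?_)
    have := (ha i).ne'
    have := (ha j).ne'
    field_simp
    ring
  rw [gap, key, key, key, h.integral_sq_snd, h.integral_sq_snd, h.integral_sq_fst,
    h.integral_sq_fst]
  have := (ha i).ne'
  have := (ha j).ne'
  field_simp
  ring

lemma integral_cost {Ω : Type*} [MeasurableSpace Ω] {P : Measure Ω} (c : Fin d → Fin d → ℝ)
    {X : Ω → Fin d → ℝ} (hX : ∀ i, MemLp (fun ω => X ω i) 2 P) :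
    ∫ ω, cost c (X ω) ∂P = ∑ i, ∑ j ∈ Finset.Ioi i, c i j * ∫ ω, X ω i * X ω j ∂P := by
  have h i j : Integrable (fun ω => c i j * X ω i * X ω j) P := by
    simp only [mul_assoc]
    exact ((hX i).integrable_mul (hX j)).const_mul _
  simp only [cost]
  rw [integral_finsetSum _ fun i _ => integrable_finsetSum _ fun j _ => h i j]
  refine Finset.sum_congr rfl fun i _ => ?_
  rw [integral_finsetSum _ fun j _ => h i j]
  refine Finset.sum_congr rfl fun j _ => ?_
  simp only [mul_assoc, integral_const_mul]

/-- The part of the value of a martingale transport that depends on the marginals only. -/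
noncomputable def incrementValue (c : Fin d → Fin d → ℝ) (μ ν : Fin d → Measure ℝ)
    (a : Fin d → ℝ) : ℝ :=
  ∑ i, ∑ j ∈ Finset.Ioi i, c i j * (a i * a j / 2 *
    ((∫ y, y * y ∂ν i - ∫ y, y * y ∂μ i) / a i ^ 2 + (∫ y, y * y ∂ν j - ∫ y, y * y ∂μ j) / a j ^ 2))

/-- The central decomposition: only the first law and the gaps vary with the transport. -/
lemma IsMartingaleTransport.integral_cost_snd (h : IsMartingaleTransport μ ν π)
    (hμ : ∀ i, MemLp (fun x : ℝ => x) 2 (μ i)) (hν : ∀ i, MemLp (fun x : ℝ => x) 2 (ν i))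
    {a : Fin d → ℝ} (ha : ∀ i, 0 < a i) (c : Fin d → Fin d → ℝ) :
    ∫ p, cost c p.2 ∂π = ∫ x, cost c x ∂π.fst + incrementValue c μ ν a
      - ∑ i, ∑ j ∈ Finset.Ioi i, c i j * (a i * a j / 2 * incrementGap a π i j) := by
  have hfst : ∫ x, cost c x ∂π.fst = ∫ p, cost c p.1 ∂π := by
    rw [Measure.fst, integral_map (by fun_prop)]
    unfold cost
    fun_prop
  rw [hfst, integral_cost c (h.memLp_fst hμ), integral_cost c (h.memLp_snd hν), incrementValue,
    ← Finset.sum_add_distrib, ← Finset.sum_sub_distrib]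
  refine Finset.sum_congr rfl fun i _ => ?_
  rw [← Finset.sum_add_distrib, ← Finset.sum_sub_distrib]
  refine Finset.sum_congr rfl fun j _ => ?_
  rw [h.integral_snd_mul_snd hμ hν ha]
  ring

lemma incrementGap_linearIncrement {a : Fin d → ℝ} (ha : ∀ i, 0 < a i) (κ : Measure ℝ)
    (γ : Measure (Fin d → ℝ)) (i j : Fin d) :
    incrementGap a (linearIncrement a κ γ) i j = 0 := by
  rw [incrementGap, linearIncrement, integral_map (by fun_prop) (by fun_prop)]
  have := (ha i).ne'
  have := (ha j).ne'
  simp [*]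

end Moments

/-! ### Structure of the maximizers. -/

section MMOT

variable {c : Fin d → Fin d → ℝ} {μ ν : Fin d → Measure ℝ} {a : Fin d → ℝ}
  {π : Measure ((Fin d → ℝ) × (Fin d → ℝ))}

/-- An MMOT does at least as well as the linear increment coupling of any transport plan. -/
lemma IsMMOT.integral_cost_le (h : IsMMOT c μ ν π)
    (hμ : ∀ i, MemLp (fun x : ℝ => x) 2 (μ i)) (hν : ∀ i, MemLp (fun x : ℝ => x) 2 (ν i))
    (hLIM : LIM μ ν a) {γ : Measure (Fin d → ℝ)} (hγ : IsTransport μ γ) :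
    ∫ x, cost c x ∂γ + ∑ i, ∑ j ∈ Finset.Ioi i, c i j * (a i * a j / 2 * incrementGap a π i j)
      ≤ ∫ x, cost c x ∂π.fst := by
  obtain ⟨ha, κ, _, hκ, hκ0, -, hconv⟩ := hLIM
  have := hγ.prob
  have hlin := isMartingaleTransport_linearIncrement hκ hκ0 hconv hγ
  have hle := h.2 _ hlin
  rw [hlin.integral_cost_snd hμ hν ha, h.1.integral_cost_snd hμ hν ha, linearIncrement_fst] at hle
  simp only [incrementGap_linearIncrement ha, mul_zero, Finset.sum_const_zero] at hle
  linarith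

lemma sum_incrementGap_nonneg (hc : ∀ i j, i < j → 0 ≤ c i j) (ha : ∀ i, 0 < a i) (i : Fin d) :
    0 ≤ ∑ j ∈ Finset.Ioi i, c i j * (a i * a j / 2 * incrementGap a π i j) :=
  Finset.sum_nonneg fun j hj => mul_nonneg (hc i j (Finset.mem_Ioi.1 hj)) <|
    mul_nonneg (div_nonneg (mul_pos (ha i) (ha j)).le zero_le_two) (incrementGap_nonneg a i j)

lemma IsMMOT.isOptimalTransport_fst (h : IsMMOT c μ ν π) (hc : ∀ i j, i < j → 0 ≤ c i j)
    (hμ : ∀ i, MemLp (fun x : ℝ => x) 2 (μ i)) (hν : ∀ i, MemLp (fun x : ℝ => x) 2 (ν i))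
    (hLIM : LIM μ ν a) : IsOptimalTransport c μ π.fst := by
  refine ⟨h.1.isTransport_fst, fun γ hγ => ?_⟩
  have h1 := h.integral_cost_le hμ hν hLIM hγ
  have h2 := Finset.sum_nonneg fun i (_ : i ∈ Finset.univ) =>
    sum_incrementGap_nonneg (π := π) hc hLIM.1 i
  linarith

lemma IsMMOT.incrementGap_eq_zero (h : IsMMOT c μ ν π) (hc : ∀ i j, i < j → 0 ≤ c i j)
    (hμ : ∀ i, MemLp (fun x : ℝ => x) 2 (μ i)) (hν : ∀ i, MemLp (fun x : ℝ => x) 2 (ν i))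
    (hLIM : LIM μ ν a) {i j : Fin d} (hij : i < j) (hcij : 0 < c i j) :
    incrementGap a π i j = 0 := by
  have ha := hLIM.1
  -- Compared with the linear increment coupling of its own first law, `π` has total penalty at most
  -- zero, so each nonnegative term vanishes.
  have h1 := h.integral_cost_le hμ hν hLIM h.1.isTransport_fst
  have h2 := Finset.single_le_sum (fun i _ => sum_incrementGap_nonneg (π := π) hc ha i)
    (Finset.mem_univ i)
  have h3 := Finset.single_le_sum (f := fun j => c i j * (a i * a j / 2 * incrementGap a π i j))
    (fun j hj => mul_nonneg (hc i j (Finset.mem_Ioi.1 hj)) <|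
      mul_nonneg (div_nonneg (mul_pos (ha i) (ha j)).le zero_le_two) (incrementGap_nonneg a i j))
    (Finset.mem_Ioi.2 hij)
  have h4 : c i j * (a i * a j / 2) * incrementGap a π i j ≤ 0 := by
    rw [mul_assoc]
    linarith
  have h5 : 0 < c i j * (a i * a j / 2) := mul_pos hcij (half_pos (mul_pos (ha i) (ha j)))
  exact le_antisymm (nonpos_of_mul_nonpos_right h4 h5) (incrementGap_nonneg a i j)

/-- Relations that are reflexive, symmetric and transitive and hold along the edges of a connected
graph hold everywhere. -/
lemma rel_of_connected (hconn : (costGraph c).Connected) {R : Fin d → Fin d → Prop}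
    (hrefl : ∀ i, R i i) (hsymm : ∀ i j, R i j → R j i) (htrans : ∀ i j k, R i j → R j k → R i k)
    (hedge : ∀ i j, i < j → 0 < c i j → R i j) (i j : Fin d) : R i j := by
  obtain ⟨w⟩ := hconn.preconnected i j
  induction w with
  | nil => exact hrefl _
  | cons hadj _ ih =>
    refine htrans _ _ _ ?_ ih
    rw [costGraph, SimpleGraph.fromRel_adj] at hadj
    rcases hadj.2 with h | h
    · exact hedge _ _ h.1 h.2
    · exact hsymm _ _ (hedge _ _ h.1 h.2)

/-- Almost sure equality of rescaled increments is an equivalence relation on indices, and zero gaps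
give it along edges. -/
lemma IsMMOT.ae_sub_mem_span (h : IsMMOT c μ ν π) (hc : ∀ i j, i < j → 0 ≤ c i j)
    (hconn : (costGraph c).Connected)
    (hμ : ∀ i, MemLp (fun x : ℝ => x) 2 (μ i)) (hν : ∀ i, MemLp (fun x : ℝ => x) 2 (ν i))
    (hLIM : LIM μ ν a) : ∀ᵐ p ∂π, p.2 - p.1 ∈ Submodule.span ℝ {a} := by
  have ha := hLIM.1
  have hrel := rel_of_connected hconn
    (R := fun i j => ∀ᵐ p ∂π, (p.2 i - p.1 i) / a i = (p.2 j - p.1 j) / a j)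
    (fun _ => .of_forall fun _ => rfl) (fun _ _ h => h.mono fun _ h => h.symm)
    (fun _ _ _ h1 h2 => by filter_upwards [h1, h2] with p h1 h2 using h1.trans h2)
    (fun i j hij hcij => by
      have D k : MemLp (fun p => (p.2 k - p.1 k) / a k) 2 π :=
        by
        simpa only [div_eq_mul_inv, Pi.sub_apply] using
          ((h.1.memLp_snd hν k).sub (h.1.memLp_fst hμ k)).mul_const (a k)⁻¹
      have h0 := h.incrementGap_eq_zero hc hμ hν hLIM hij hcij
      filter_upwards [(integral_eq_zero_iff_of_nonneg (fun _ => sq_nonneg _)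
        ((D i).sub (D j)).integrable_sq).1 h0] with p hp
      exact sub_eq_zero.1 (pow_eq_zero_iff two_ne_zero |>.1 hp))
  obtain ⟨i⟩ := hconn.nonempty
  filter_upwards [ae_all_iff.2 (hrel i)] with p hp
  refine Submodule.mem_span_singleton.2 ⟨(p.2 i - p.1 i) / a i, funext fun j => ?_⟩
  rw [hp j, Pi.smul_apply, smul_eq_mul, div_mul_cancel₀ _ (ha j).ne', Pi.sub_apply]

/-- The line is closed: this makes the event measurable, so that it disintegrates, and upgrades full
mass to containment of the support. -/
lemma IsMMOT.support_subset (h : IsMMOT c μ ν π) (hc : ∀ i j, i < j → 0 ≤ c i j)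
    (hconn : (costGraph c).Connected)
    (hμ : ∀ i, MemLp (fun x : ℝ => x) 2 (μ i)) (hν : ∀ i, MemLp (fun x : ℝ => x) 2 (ν i))
    (hLIM : LIM μ ν a) (K : Kernel (Fin d → ℝ) (Fin d → ℝ)) [IsMarkovKernel K]
    (hK : π = π.fst.compProd K) :
    ∀ᵐ x ∂π.fst, (K x).support ⊆ {y | y - x ∈ Submodule.span ℝ {a}} := by
  have := h.1.prob
  have hL : IsClosed (Submodule.span ℝ {a} : Set (Fin d → ℝ)) :=
    Submodule.closed_of_finiteDimensional _
  have hae := h.ae_sub_mem_span hc hconn hμ hν hLIM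
  rw [hK] at hae
  have hmeas : MeasurableSet
      {p : (Fin d → ℝ) × (Fin d → ℝ) | p.2 - p.1 ∈ Submodule.span ℝ {a}} :=
    (hL.preimage (continuous_snd.sub continuous_fst)).measurableSet
  filter_upwards [(Measure.ae_compProd_iff hmeas).1 hae] with x hx
  exact Measure.support_subset_of_isClosed (hL.preimage (continuous_id.sub continuous_const)) hx

end MMOT

open Filter Topology

/-! ### Almost sure comonotonicity. -/

section Comonotone

variable {Ω : Type*} [MeasurableSpace Ω] {P : Measure Ω} {X Y Z : Ω → ℝ}

/-- `X` and `Y` are almost surely comonotone: their superlevel sets are nested up to null sets. -/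
def AEComonotone (P : Measure Ω) (X Y : Ω → ℝ) : Prop :=
  ∀ s t, {ω | s < X ω} ≤ᵐ[P] {ω | t < Y ω} ∨ {ω | t < Y ω} ≤ᵐ[P] {ω | s < X ω}

lemma AEComonotone.refl (X : Ω → ℝ) : AEComonotone P X X := fun s t =>
  (le_total t s).imp (fun h => .of_forall fun _ hω => h.trans_lt hω)
    fun h => .of_forall fun _ hω => h.trans_lt hω

lemma AEComonotone.symm (h : AEComonotone P X Y) : AEComonotone P Y X := fun s t => (h t s).symm

/-- Absence of atoms makes the cdf continuous, and the intermediate value theorem applies. -/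
lemma exists_measure_Ioi_eq {μ : Measure ℝ} [IsProbabilityMeasure μ] (hμ : ∀ x, μ {x} = 0)
    {u : ℝ} (h0 : 0 < u) (h1 : u < 1) : ∃ r, μ.real (Set.Ioi r) = u := by
  have hcont : Continuous (cdf μ) := by
    refine continuous_iff_continuousAt.2 fun x => ?_
    rw [(monotone_cdf μ).continuousAt_iff_leftLim_eq_rightLim, StieltjesFunction.rightLim_eq]
    have := (cdf μ).measure_singleton x
    rw [measure_cdf, hμ x, eq_comm, ENNReal.ofReal_eq_zero] at this
    exact le_antisymm ((monotone_cdf μ).leftLim_le le_rfl) (by linarith)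
  obtain ⟨x, hx⟩ := ((tendsto_cdf_atBot μ).eventually_lt_const (sub_pos.2 h1)).exists
  obtain ⟨y, hy⟩ := ((tendsto_cdf_atTop μ).eventually_const_lt (sub_lt_self 1 h0)).exists
  obtain ⟨r, hr⟩ := mem_range_of_exists_le_of_exists_ge hcont ⟨x, hx.le⟩ ⟨y, hy.le⟩
  refine ⟨r, ?_⟩
  rw [← Set.compl_Iic, probReal_compl_eq_one_sub measurableSet_Iic, ← cdf_eq_real, hr]
  ring

/-- Nested sets of equal mass agree almost everywhere, so `{s < X}` can be replaced by a superlevel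
set of `Y` with the same mass. Atoms of `Y` would break this: a constant is comonotone with
everything. -/
lemma AEComonotone.trans [IsProbabilityMeasure P] (hX : Measurable X) (hY : Measurable Y)
    (hY0 : ∀ y, P.map Y {y} = 0) (hXY : AEComonotone P X Y) (hYZ : AEComonotone P Y Z) :
    AEComonotone P X Z := by
  intro s t
  have hAm : MeasurableSet {ω | s < X ω} := measurableSet_lt measurable_const hX
  -- Masses 0 and 1 are treated separately, since `Y` may have no finite level realizing them.
  rcases (measureReal_nonneg (μ := P) (s := {ω | s < X ω})).eq_or_lt with h0 | h0
  · left
    have : P {ω | s < X ω} = 0 := (measureReal_eq_zero_iff).1 h0.symm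
    exact (ae_eq_empty.2 this).le.trans (.of_forall fun _ h => h.elim)
  rcases (measureReal_le_one (μ := P) (s := {ω | s < X ω})).eq_or_lt with h1 | h1
  · right
    have : ∀ᵐ ω ∂P, ω ∈ {ω | s < X ω} := by
      refine (mem_ae_iff_prob_eq_one hAm).2 ?_
      rw [← ofReal_measureReal, h1, ENNReal.ofReal_one]
    exact this.mono fun _ h _ => h
  have := Measure.isProbabilityMeasure_map (μ := P) hY.aemeasurable
  obtain ⟨r, hr⟩ := exists_measure_Ioi_eq hY0 h0 h1
  rw [map_measureReal_apply hY measurableSet_Ioi] at hr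
  have hr' : P (Y ⁻¹' Set.Ioi r) = P {ω | s < X ω} := (measureReal_eq_measureReal_iff).1 hr
  have heq : {ω | s < X ω} =ᵐ[P] {ω | r < Y ω} := by
    rcases hXY s r with h | h
    · exact ae_eq_of_ae_subset_of_measure_ge h hr'.le hAm.nullMeasurableSet (measure_ne_top _ _)
    · exact (ae_eq_of_ae_subset_of_measure_ge h hr'.ge
        (hY measurableSet_Ioi).nullMeasurableSet (measure_ne_top _ _)).symm
  exact (hYZ r t).imp (fun h => heq.le.trans h) fun h => h.trans heq.symm.le

lemma AEComonotone.measureReal_inter [IsFiniteMeasure P] (h : AEComonotone P X Y) (s t : ℝ) :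
    P.real ({ω | s < X ω} ∩ {ω | t < Y ω}) = min (P.real {ω | s < X ω}) (P.real {ω | t < Y ω}) := by
  have aux (A B : Set Ω) (h : A ≤ᵐ[P] B) : P.real (A ∩ B) = min (P.real A) (P.real B) := by
    have hle : P.real A ≤ P.real B :=
      ENNReal.toReal_mono (measure_ne_top _ _) (measure_mono_ae h)
    rw [min_eq_left hle]
    refine measureReal_congr ?_
    filter_upwards [h] with ω hω
    exact propext ⟨fun h => h.1, fun h => ⟨h, hω h⟩⟩
  rcases h s t with h | h
  · exact aux _ _ h
  · rw [Set.inter_comm, aux _ _ h, min_comm]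

lemma aeComonotone_of_measureReal_inter [IsFiniteMeasure P] (hX : Measurable X) (hY : Measurable Y)
    (h : ∀ s t, min (P.real {ω | s < X ω}) (P.real {ω | t < Y ω})
      ≤ P.real ({ω | s < X ω} ∩ {ω | t < Y ω})) : AEComonotone P X Y := by
  intro s t
  have hA : MeasurableSet {ω | s < X ω} := measurableSet_lt measurable_const hX
  have hB : MeasurableSet {ω | t < Y ω} := measurableSet_lt measurable_const hY
  have aux (A B : Set Ω) (hA : MeasurableSet A) (hB : MeasurableSet B)
      (h : P.real A ≤ P.real (A ∩ B)) : A ≤ᵐ[P] B := by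
    have := ae_eq_of_ae_subset_of_measure_ge (μ := P)
      (Set.inter_subset_left (s := A) (t := B)).eventuallyLE
      ((ENNReal.toReal_le_toReal (measure_ne_top _ _) (measure_ne_top _ _)).1 h)
      (hA.inter hB).nullMeasurableSet (measure_ne_top _ _)
    exact this.symm.le.trans Set.inter_subset_right.eventuallyLE
  rcases min_le_iff.1 (h s t) with h | h
  · exact .inl (aux _ _ hA hB h)
  · rw [Set.inter_comm] at h
    exact .inr (aux _ _ hB hA h)

end Comonotone

/-! ### Hoeffding's formula and its equality case. -/

section Hoeffding

variable {Ω : Type*} [MeasurableSpace Ω] {P : Measure Ω} {X Y : Ω → ℝ}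

/-- The layer function `1_{s < x} - 1_{s < 0}`, whose integral in `s` is `x`. -/
noncomputable def layer (s x : ℝ) : ℝ := (if s < x then 1 else 0) - if s < 0 then 1 else 0

lemma measurable_layer : Measurable fun q : ℝ × ℝ => layer q.1 q.2 := by
  unfold layer
  refine Measurable.sub (Measurable.ite (measurableSet_lt ?_ ?_) ?_ ?_)
    (Measurable.ite (measurableSet_lt ?_ ?_) ?_ ?_) <;> fun_prop

lemma layer_of_nonneg {x : ℝ} (hx : 0 ≤ x) :
    (fun s => layer s x) = (Set.Ico 0 x).indicator fun _ => 1 := by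
  ext s
  simp only [layer, Set.indicator_apply, Set.mem_Ico]
  grind

lemma layer_of_nonpos {x : ℝ} (hx : x ≤ 0) :
    (fun s => layer s x) = (Set.Ico x 0).indicator fun _ => -1 := by
  ext s
  simp only [layer, Set.indicator_apply, Set.mem_Ico]
  grind

lemma integrable_layer (x : ℝ) : Integrable (fun s => layer s x) := by
  rcases le_total 0 x with hx | hx
  · rw [layer_of_nonneg hx, integrable_indicator_iff measurableSet_Ico]
    exact integrableOn_const (by simp)
  · rw [layer_of_nonpos hx, integrable_indicator_iff measurableSet_Ico]
    exact integrableOn_const (by simp)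

lemma integral_layer (x : ℝ) : ∫ s, layer s x = x := by
  rcases le_total 0 x with hx | hx
  · rw [layer_of_nonneg hx, integral_indicator measurableSet_Ico]
    simp [hx]
  · rw [layer_of_nonpos hx, integral_indicator measurableSet_Ico]
    simp [hx]

lemma integral_norm_layer (x : ℝ) : ∫ s, ‖layer s x‖ = |x| := by
  rcases le_total 0 x with hx | hx
  · have : (fun s => ‖layer s x‖) = (Set.Ico 0 x).indicator fun _ => 1 := by
      ext s
      simp only [congrFun (layer_of_nonneg hx) s, Set.indicator_apply]
      split_ifs <;> simp
    rw [this, integral_indicator measurableSet_Ico]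
    simp [hx, abs_of_nonneg]
  · have : (fun s => ‖layer s x‖) = (Set.Ico x 0).indicator fun _ => 1 := by
      ext s
      simp only [congrFun (layer_of_nonpos hx) s, Set.indicator_apply]
      split_ifs <;> simp
    rw [this, integral_indicator measurableSet_Ico]
    simp [hx, abs_of_nonpos]

/-- Integrating the norm over both levels first leaves `|X Y|`. -/
lemma integrable_layer_mul_layer [SFinite P] (hX : Measurable X) (hY : Measurable Y)
    (hXY : Integrable (fun ω => X ω * Y ω) P) :
    Integrable (fun q : Ω × (ℝ × ℝ) => layer q.2.1 (X q.1) * layer q.2.2 (Y q.1))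
      (P.prod volume) := by
  have hm : Measurable fun q : Ω × (ℝ × ℝ) => layer q.2.1 (X q.1) * layer q.2.2 (Y q.1) :=
    (measurable_layer.comp (f := fun q : Ω × (ℝ × ℝ) => (q.2.1, X q.1)) (by fun_prop)).mul
      (measurable_layer.comp (f := fun q : Ω × (ℝ × ℝ) => (q.2.2, Y q.1)) (by fun_prop))
  rw [integrable_prod_iff hm.aestronglyMeasurable]
  refine ⟨.of_forall fun ω => (integrable_layer (X ω)).mul_prod (integrable_layer (Y ω)), ?_⟩
  have : ∀ ω, ∫ q : ℝ × ℝ, ‖layer q.1 (X ω) * layer q.2 (Y ω)‖ = ‖X ω * Y ω‖ := fun ω => by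
    simp only [norm_mul]
    rw [Measure.volume_eq_prod, integral_prod_mul (fun s => ‖layer s (X ω)‖)
      (fun t => ‖layer t (Y ω)‖), integral_norm_layer, integral_norm_layer]
    rfl
  simp only [this]
  exact hXY.norm

/-- Hoeffding's formula. -/
lemma integral_mul_eq_integral_layer [SFinite P] (hX : Measurable X) (hY : Measurable Y)
    (hXY : Integrable (fun ω => X ω * Y ω) P) :
    ∫ ω, X ω * Y ω ∂P = ∫ q : ℝ × ℝ, ∫ ω, layer q.1 (X ω) * layer q.2 (Y ω) ∂P := by
  rw [← integral_integral_swap (f := fun ω (q : ℝ × ℝ) => layer q.1 (X ω) * layer q.2 (Y ω))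
    (integrable_layer_mul_layer hX hY hXY)]
  refine integral_congr_ae (.of_forall fun ω => ?_)
  simp only
  rw [Measure.volume_eq_prod, integral_prod_mul (fun s => layer s (X ω))
    (fun t => layer t (Y ω)), integral_layer, integral_layer]

/-- Only the first term sees the joint law; the others cancel when couplings with the same marginals
are compared. -/
lemma integral_layer_mul_layer [IsProbabilityMeasure P] (hX : Measurable X) (hY : Measurable Y)
    (s t : ℝ) : ∫ ω, layer s (X ω) * layer t (Y ω) ∂P
      = P.real ({ω | s < X ω} ∩ {ω | t < Y ω}) - (if t < 0 then 1 else 0) * P.real {ω | s < X ω}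
        - (if s < 0 then 1 else 0) * P.real {ω | t < Y ω}
        + (if s < 0 then 1 else 0) * (if t < 0 then 1 else 0) := by
  have hA : MeasurableSet {ω | s < X ω} := measurableSet_lt measurable_const hX
  have hB : MeasurableSet {ω | t < Y ω} := measurableSet_lt measurable_const hY
  have e : (fun ω => layer s (X ω) * layer t (Y ω)) = fun ω =>
      ({ω | s < X ω} ∩ {ω | t < Y ω}).indicator (fun _ => (1 : ℝ)) ω
        - (if t < 0 then 1 else 0) * {ω | s < X ω}.indicator (fun _ => (1 : ℝ)) ω
        - (if s < 0 then 1 else 0) * {ω | t < Y ω}.indicator (fun _ => (1 : ℝ)) ω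
        + (if s < 0 then 1 else 0) * (if t < 0 then 1 else 0) := by
    ext ω
    simp only [layer, Set.indicator_apply, Set.mem_inter_iff, Set.mem_ofPred_eq]
    split_ifs <;> simp_all
  have i1 : Integrable (({ω | s < X ω} ∩ {ω | t < Y ω}).indicator (fun _ => (1 : ℝ))) P :=
    (integrable_const 1).indicator (hA.inter hB)
  have i2 : Integrable ({ω | s < X ω}.indicator (fun _ => (1 : ℝ))) P :=
    (integrable_const 1).indicator hA
  have i3 : Integrable ({ω | t < Y ω}.indicator (fun _ => (1 : ℝ))) P :=
    (integrable_const 1).indicator hB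
  rw [e, integral_add (by fun_prop) (by fun_prop), integral_sub (by fun_prop) (by fun_prop),
    integral_sub (by fun_prop) (by fun_prop), integral_const_mul, integral_const_mul,
    integral_indicator_const _ hA, integral_indicator_const _ hB,
    integral_indicator_const _ (hA.inter hB)]
  simp

variable {Ω' : Type*} [MeasurableSpace Ω'] {P' : Measure Ω'} {X' Y' : Ω' → ℝ}

lemma measureReal_lt_eq_of_map_eq (hX : Measurable X) (hX' : Measurable X')
    (h : P.map X = P'.map X') (s : ℝ) : P.real {ω | s < X ω} = P'.real {ω | s < X' ω} := by
  have := congrArg (fun μ => μ.real (Set.Ioi s)) h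
  simp only [map_measureReal_apply hX measurableSet_Ioi,
    map_measureReal_apply hX' measurableSet_Ioi] at this
  exact this

variable [IsProbabilityMeasure P] [IsProbabilityMeasure P']

lemma integral_layer_mul_layer_sub (hX : Measurable X) (hY : Measurable Y) (hX' : Measurable X')
    (hY' : Measurable Y') (hXX' : P.map X = P'.map X') (hYY' : P.map Y = P'.map Y') (s t : ℝ) :
    ∫ ω, layer s (X' ω) * layer t (Y' ω) ∂P' - ∫ ω, layer s (X ω) * layer t (Y ω) ∂P
      = P'.real ({ω | s < X' ω} ∩ {ω | t < Y' ω}) - P.real ({ω | s < X ω} ∩ {ω | t < Y ω}) := by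
  rw [integral_layer_mul_layer hX hY, integral_layer_mul_layer hX' hY',
    measureReal_lt_eq_of_map_eq hX hX' hXX', measureReal_lt_eq_of_map_eq hY hY' hYY']
  ring

lemma AEComonotone.measureReal_inter_le (h : AEComonotone P' X' Y') (hX : Measurable X)
    (hY : Measurable Y) (hX' : Measurable X') (hY' : Measurable Y') (hXX' : P.map X = P'.map X')
    (hYY' : P.map Y = P'.map Y') (s t : ℝ) :
    P.real ({ω | s < X ω} ∩ {ω | t < Y ω}) ≤ P'.real ({ω | s < X' ω} ∩ {ω | t < Y' ω}) := by
  rw [h.measureReal_inter, ← measureReal_lt_eq_of_map_eq hX hX' hXX',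
    ← measureReal_lt_eq_of_map_eq hY hY' hYY']
  exact le_min (measureReal_mono Set.inter_subset_left) (measureReal_mono Set.inter_subset_right)

/-- Comonotone random variables maximize the mixed second moment among all couplings. -/
lemma AEComonotone.integral_mul_le (h : AEComonotone P' X' Y') (hX : Measurable X)
    (hY : Measurable Y) (hX' : Measurable X') (hY' : Measurable Y') (hXX' : P.map X = P'.map X')
    (hYY' : P.map Y = P'.map Y') (hXY : Integrable (fun ω => X ω * Y ω) P)
    (hXY' : Integrable (fun ω => X' ω * Y' ω) P') :
    ∫ ω, X ω * Y ω ∂P ≤ ∫ ω, X' ω * Y' ω ∂P' := by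
  rw [integral_mul_eq_integral_layer hX hY hXY, integral_mul_eq_integral_layer hX' hY' hXY']
  refine integral_mono (integrable_layer_mul_layer hX hY hXY).integral_prod_right
    (integrable_layer_mul_layer hX' hY' hXY').integral_prod_right fun q => sub_nonneg.1 ?_
  rw [integral_layer_mul_layer_sub hX hY hX' hY' hXX' hYY']
  exact sub_nonneg.2 (h.measureReal_inter_le hX hY hX' hY' hXX' hYY' _ _)

/-- Right continuity of the cdf lets the strict bound survive slightly above `s`; monotonicity
covers all lower levels. -/
lemma exists_forall_Ioo_lt_measureReal (hX : Measurable X) {s u : ℝ}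
    (h : u < P.real {ω | s < X ω}) : ∃ s' > s, ∀ r < s', u < P.real {ω | r < X ω} := by
  have := Measure.isProbabilityMeasure_map (μ := P) hX.aemeasurable
  have e r : P.real {ω | r < X ω} = 1 - cdf (P.map X) r := by
    rw [cdf_eq_real, ← probReal_compl_eq_one_sub measurableSet_Iic, Set.compl_Iic,
      map_measureReal_apply hX measurableSet_Ioi]
    rfl
  have hlim : Tendsto (fun r => 1 - cdf (P.map X) r) (𝓝[>] s) (𝓝 (1 - cdf (P.map X) s)) :=
    (((cdf (P.map X)).right_continuous s).mono Set.Ioi_subset_Ici_self).tendsto.const_sub 1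
  rw [e] at h
  obtain ⟨r, hr, hsr⟩ := ((hlim.eventually_const_lt h).and self_mem_nhdsWithin).exists
  refine ⟨r, hsr, fun r' hr' => ?_⟩
  rw [e]
  exact hr.trans_le (sub_le_sub_left (monotone_cdf _ hr'.le) 1)

/-- A coupling with the same mixed second moment as a comonotone one is comonotone. -/
lemma AEComonotone.of_integral_mul_le (h : AEComonotone P' X' Y') (hX : Measurable X)
    (hY : Measurable Y) (hX' : Measurable X') (hY' : Measurable Y') (hXX' : P.map X = P'.map X')
    (hYY' : P.map Y = P'.map Y') (hXY : Integrable (fun ω => X ω * Y ω) P)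
    (hXY' : Integrable (fun ω => X' ω * Y' ω) P')
    (hle : ∫ ω, X' ω * Y' ω ∂P' ≤ ∫ ω, X ω * Y ω ∂P) : AEComonotone P X Y := by
  have i1 := (integrable_layer_mul_layer hX hY hXY).integral_prod_right
  have i2 := (integrable_layer_mul_layer hX' hY' hXY').integral_prod_right
  rw [integral_mul_eq_integral_layer hX hY hXY, integral_mul_eq_integral_layer hX' hY' hXY',
    ← sub_nonpos, ← integral_sub i2 i1] at hle
  simp only [integral_layer_mul_layer_sub hX hY hX' hY' hXX' hYY'] at hle
  have hnonneg (q : ℝ × ℝ) := sub_nonneg.2 (h.measureReal_inter_le hX hY hX' hY' hXX' hYY' q.1 q.2)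
  have i3 := i2.sub i1
  have hzero := (integral_eq_zero_iff_of_nonneg hnonneg (i3.congr (.of_forall fun q =>
    integral_layer_mul_layer_sub hX hY hX' hY' hXX' hYY' q.1 q.2))).1
      (hle.antisymm (integral_nonneg hnonneg))
  -- Almost every pair of levels gives equality, hence a dense set does. A strict deficit at `(s,
  -- t)` would persist on an open rectangle above and to the right of it, because the joint mass
  -- only decreases there; that rectangle contains a point of equality.
  have hdense := Measure.dense_of_ae hzero
  refine aeComonotone_of_measureReal_inter hX hY fun s t => ?_
  by_contra! hlt
  obtain ⟨s', hs', hs⟩ := exists_forall_Ioo_lt_measureReal hX (lt_min_iff.1 hlt).1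
  obtain ⟨t', ht', ht⟩ := exists_forall_Ioo_lt_measureReal hY (lt_min_iff.1 hlt).2
  obtain ⟨q, hq, hq0⟩ := hdense.exists_mem_open (isOpen_Ioo.prod isOpen_Ioo)
    (((Set.nonempty_Ioo.2 hs').prod (Set.nonempty_Ioo.2 ht')) :
      (Set.Ioo s s' ×ˢ Set.Ioo t t').Nonempty)
  have hq1 := sub_eq_zero.1 hq
  rw [h.measureReal_inter, ← measureReal_lt_eq_of_map_eq hX hX' hXX',
    ← measureReal_lt_eq_of_map_eq hY hY' hYY'] at hq1
  have hmono : P.real ({ω | q.1 < X ω} ∩ {ω | q.2 < Y ω})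
      ≤ P.real ({ω | s < X ω} ∩ {ω | t < Y ω}) :=
    measureReal_mono fun ω hω => ⟨hq0.1.1.trans hω.1, hq0.2.1.trans hω.2⟩
  rw [← hq1] at hmono
  exact (lt_min (hs _ hq0.1.2) (ht _ hq0.2.2)).not_ge hmono

end Hoeffding

/-! ### The quantile coupling. -/

section Quantile

/-- The quantile function of a probability measure on `ℝ`. -/
noncomputable def quantile (μ : Measure ℝ) (u : Set.Ioo (0 : ℝ) 1) : ℝ :=
  sInf {x | (u : ℝ) ≤ cdf μ x}

variable (μ : Measure ℝ) (u : Set.Ioo (0 : ℝ) 1)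

/-- Right continuity of the cdf is what makes the infimum satisfy the defining inequality. -/
lemma quantile_le_iff (x : ℝ) : quantile μ u ≤ x ↔ (u : ℝ) ≤ cdf μ x := by
  have hbdd : BddBelow {x | (u : ℝ) ≤ cdf μ x} := by
    obtain ⟨y, hy⟩ := ((tendsto_cdf_atBot μ).eventually_lt_const u.2.1).exists
    exact ⟨y, fun z hz => le_of_not_gt fun h => (hz.trans (monotone_cdf μ h.le)).not_gt hy⟩
  have hne : {x | (u : ℝ) ≤ cdf μ x}.Nonempty := by
    obtain ⟨y, hy⟩ := ((tendsto_cdf_atTop μ).eventually_const_lt u.2.2).exists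
    exact ⟨y, hy.le⟩
  refine ⟨fun h => ?_, fun h => csInf_le hbdd h⟩
  have hlim : Tendsto (cdf μ) (𝓝[>] x) (𝓝 (cdf μ x)) :=
    (((cdf μ).right_continuous x).mono Set.Ioi_subset_Ici_self).tendsto
  refine ge_of_tendsto hlim ?_
  filter_upwards [self_mem_nhdsWithin] with y hy
  obtain ⟨z, hz, hzy⟩ := exists_lt_of_csInf_lt hne (lt_of_le_of_lt h hy)
  exact hz.trans (monotone_cdf μ hzy.le)

lemma measurable_quantile : Measurable (quantile μ) := by
  refine measurable_of_Iic fun x => ?_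
  have : quantile μ ⁻¹' Set.Iic x = {u : Set.Ioo (0 : ℝ) 1 | (u : ℝ) ≤ cdf μ x} := by
    ext u
    exact quantile_le_iff μ u x
  rw [this]
  exact measurableSet_le measurable_subtype_coe measurable_const

/-- The uniform distribution on the open unit interval. -/
noncomputable def uniform : Measure (Set.Ioo (0 : ℝ) 1) := (volume : Measure ℝ).comap (↑)

instance isProbabilityMeasure_uniform : IsProbabilityMeasure uniform := by
  refine ⟨?_⟩
  rw [uniform, comap_subtype_coe_apply measurableSet_Ioo, Set.image_univ, Subtype.range_coe]
  simp

lemma map_quantile [IsProbabilityMeasure μ] : uniform.map (quantile μ) = μ := by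
  have := Measure.isProbabilityMeasure_map (μ := uniform) (measurable_quantile μ).aemeasurable
  refine Measure.ext_of_Iic _ _ fun x => ?_
  rw [Measure.map_apply (measurable_quantile μ) measurableSet_Iic, uniform,
    comap_subtype_coe_apply measurableSet_Ioo, ← ofReal_cdf]
  have himg : ((↑) : Set.Ioo (0 : ℝ) 1 → ℝ) '' (quantile μ ⁻¹' Set.Iic x)
      = Set.Ioo 0 1 ∩ Set.Iic (cdf μ x) := by
    ext v
    constructor
    · rintro ⟨u, hu, rfl⟩
      exact ⟨u.2, (quantile_le_iff μ u x).1 hu⟩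
    · rintro ⟨hv, hvx⟩
      exact ⟨⟨v, hv⟩, (quantile_le_iff μ ⟨v, hv⟩ x).2 hvx, rfl⟩
  rw [himg]
  -- The right endpoint belongs to the set only when the cdf is below 1, so the set is squeezed
  -- between an open and a half-open interval of equal length.
  refine le_antisymm ?_ ?_
  · refine (measure_mono (t := Set.Ioc 0 (cdf μ x)) fun v hv => ⟨hv.1.1, hv.2⟩).trans_eq ?_
    simp
  · refine Eq.trans_le ?_ (measure_mono (s := Set.Ioo 0 (cdf μ x)) fun v hv =>
      ⟨⟨hv.1, hv.2.trans_le (cdf_le_one μ x)⟩, hv.2.le⟩)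
    simp

/-- Every superlevel set is an upper interval `{u | F(s) < u}`, with `F` the cdf, and such intervals
are nested. -/
lemma aeComonotone_quantile (μ ν : Measure ℝ) :
    AEComonotone uniform (quantile μ) (quantile ν) := by
  intro s t
  have e (μ : Measure ℝ) (s : ℝ) (u : Set.Ioo (0 : ℝ) 1) : s < quantile μ u ↔ cdf μ s < u := by
    rw [← not_le, quantile_le_iff, not_le]
  rcases le_total (cdf ν t) (cdf μ s) with h | h
  · exact .inl (.of_forall fun u hu => (e ν t u).2 (h.trans_lt ((e μ s u).1 hu)))
  · exact .inr (.of_forall fun u hu => (e μ s u).2 (h.trans_lt ((e ν t u).1 hu)))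

end Quantile

/-! ### Uniqueness of the optimal plan. -/

section Uniqueness

variable {d : ℕ} {c : Fin d → Fin d → ℝ} {μ : Fin d → Measure ℝ} {γ γ' : Measure (Fin d → ℝ)}

lemma memLp_quantile [∀ i, IsProbabilityMeasure (μ i)]
    (hμ : ∀ i, MemLp (fun x : ℝ => x) 2 (μ i)) (i : Fin d) : MemLp (quantile (μ i)) 2 uniform := by
  have := hμ i
  rw [← map_quantile (μ i)] at this
  exact (memLp_map_measure_iff measurable_id.aestronglyMeasurable
    (measurable_quantile _).aemeasurable).1 this

/-- The comonotone coupling is a transport plan. -/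
lemma isTransport_map_quantile [∀ i, IsProbabilityMeasure (μ i)]
    (hμ : ∀ i, MemLp (fun x : ℝ => x) 2 (μ i)) :
    IsTransport μ (uniform.map fun u i => quantile (μ i) u) := by
  have hm : Measurable fun u i => quantile (μ i) u :=
    measurable_pi_lambda _ fun i => measurable_quantile (μ i)
  refine ⟨Measure.isProbabilityMeasure_map hm.aemeasurable, ?_, fun i => ?_⟩
  · refine (integrable_map_measure measurable_id.aestronglyMeasurable hm.aemeasurable).2 ?_
    exact Integrable.of_eval fun i => (memLp_quantile hμ i).integrable (by simp)
  · rw [Measure.map_map (measurable_pi_apply i) hm]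
    exact map_quantile (μ i)

/-- The quantile coupling dominates term by term, while optimality gives the reverse inequality for
the sum. So every term is an equality, and `c i j > 0` can be cancelled. -/
lemma IsOptimalTransport.aeComonotone_of_pos (h : IsOptimalTransport c μ γ)
    (hc : ∀ i j, i < j → 0 ≤ c i j) [∀ i, IsProbabilityMeasure (μ i)]
    (hμ : ∀ i, MemLp (fun x : ℝ => x) 2 (μ i)) {i j : Fin d} (hij : i < j) (hcij : 0 < c i j) :
    AEComonotone γ (fun x => x i) (fun x => x j) := by
  have := h.1.prob
  have hm : Measurable fun u i => quantile (μ i) u :=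
    measurable_pi_lambda _ fun i => measurable_quantile (μ i)
  have hX := h.1.memLp hμ
  have hQ := memLp_quantile hμ
  have hmap k : γ.map (fun x => x k) = uniform.map (quantile (μ k)) := by
    rw [h.1.marginal, map_quantile]
  have hle := h.2 _ (isTransport_map_quantile hμ)
  rw [integral_map hm.aemeasurable (by unfold cost; fun_prop),
    integral_cost c (X := fun u i => quantile (μ i) u) hQ, integral_cost c (X := fun x => x) hX]
    at hle
  have hterm (k l : Fin d) : ∫ x, x k * x l ∂γ ≤ ∫ u, quantile (μ k) u * quantile (μ l) u ∂uniform :=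
    (aeComonotone_quantile (μ k) (μ l)).integral_mul_le (measurable_pi_apply k)
      (measurable_pi_apply l) (measurable_quantile _) (measurable_quantile _) (hmap k) (hmap l)
      ((hX k).integrable_mul (hX l)) ((hQ k).integrable_mul (hQ l))
  have hcl k : ∀ l ∈ Finset.Ioi k, c k l * ∫ x, x k * x l ∂γ
      ≤ c k l * ∫ u, quantile (μ k) u * quantile (μ l) u ∂uniform := fun l hl =>
    mul_le_mul_of_nonneg_left (hterm k l) (hc k l (Finset.mem_Ioi.1 hl))
  have heq := (Finset.sum_eq_sum_iff_of_le fun k _ => Finset.sum_le_sum (hcl k)).1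
    ((Finset.sum_le_sum fun k _ => Finset.sum_le_sum (hcl k)).antisymm hle) i (Finset.mem_univ i)
  have heq' := (Finset.sum_eq_sum_iff_of_le (hcl i)).1 heq j (Finset.mem_Ioi.2 hij)
  exact (aeComonotone_quantile (μ i) (μ j)).of_integral_mul_le (measurable_pi_apply i)
    (measurable_pi_apply j) (measurable_quantile _) (measurable_quantile _) (hmap i) (hmap j)
    ((hX i).integrable_mul (hX j)) ((hQ i).integrable_mul (hQ j))
    (mul_left_cancel₀ hcij.ne' heq').ge

lemma IsOptimalTransport.aeComonotone (h : IsOptimalTransport c μ γ)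
    (hc : ∀ i j, i < j → 0 ≤ c i j) (hconn : (costGraph c).Connected)
    [∀ i, IsProbabilityMeasure (μ i)] (hμ : ∀ i, MemLp (fun x : ℝ => x) 2 (μ i))
    (hatom : ∀ i x, μ i {x} = 0) (i j : Fin d) :
    AEComonotone γ (fun x => x i) (fun x => x j) := by
  have := h.1.prob
  exact rel_of_connected hconn (R := fun i j => AEComonotone γ (fun x => x i) (fun x => x j))
    (fun i => .refl _) (fun _ _ h => h.symm)
    (fun i j k h1 h2 => h1.trans (measurable_pi_apply i) (measurable_pi_apply j)
      (fun y => by rw [h.1.marginal, hatom]) h2)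
    (fun i j hij hcij => h.aeComonotone_of_pos hc hμ hij hcij) i j

/-- Under pairwise comonotonicity, the mass of an upper orthant is the least marginal mass. -/
lemma IsTransport.measure_pi_Ioi (h : IsTransport μ γ)
    (hco : ∀ i j, AEComonotone γ (fun x => x i) (fun x => x j)) (s : Fin d → ℝ) {i : Fin d}
    (hi : ∀ j, μ i (Set.Ioi (s i)) ≤ μ j (Set.Ioi (s j))) :
    γ (Set.univ.pi fun j => Set.Ioi (s j)) = μ i (Set.Ioi (s i)) := by
  have := h.prob
  have hmarg j : μ j (Set.Ioi (s j)) = γ {x | s j < x j} := by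
    rw [← h.marginal j, Measure.map_apply (measurable_pi_apply j) measurableSet_Ioi]
    rfl
  have hm j : NullMeasurableSet {x : Fin d → ℝ | s j < x j} γ :=
    (measurable_pi_apply j measurableSet_Ioi).nullMeasurableSet
  -- Index `i` has the least mass, so if the inclusion goes the other way the two sets have equal
  -- mass and coincide almost everywhere.
  have hle j : {x : Fin d → ℝ | s i < x i} ≤ᵐ[γ] {x | s j < x j} := by
    refine (hco i j (s i) (s j)).elim id fun h' => ?_
    refine (ae_eq_of_ae_subset_of_measure_ge h' ?_ (hm j) (measure_ne_top _ _)).symm.le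
    rw [← hmarg, ← hmarg]
    exact hi j
  rw [hmarg]
  refine measure_congr ?_
  filter_upwards [ae_all_iff.2 hle] with x hx
  exact propext ⟨fun h => h i (Set.mem_univ i), fun h j _ => hx j h⟩

/-- Upper orthants form a generating π-system, and their masses are read off from the marginals. -/
lemma IsTransport.eq_of_aeComonotone [Nonempty (Fin d)] (h : IsTransport μ γ)
    (h' : IsTransport μ γ') (hco : ∀ i j, AEComonotone γ (fun x => x i) (fun x => x j))
    (hco' : ∀ i j, AEComonotone γ' (fun x => x i) (fun x => x j)) : γ = γ' := by
  have := h.prob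
  have := h'.prob
  have hspan : IsCountablySpanning (Set.range (Set.Ioi : ℝ → Set ℝ)) := by
    refine ⟨fun n : ℕ => Set.Ioi (-n : ℝ), fun n => ⟨_, rfl⟩, Set.eq_univ_of_forall fun x => ?_⟩
    obtain ⟨n, hn⟩ := exists_nat_gt (-x)
    exact Set.mem_iUnion.2 ⟨n, by simpa using neg_lt.1 hn⟩
  refine ext_of_generate_finite _ (generateFrom_eq_pi (α := fun _ : Fin d => ℝ)
    (C := fun _ => Set.range Set.Ioi) (fun _ => ?_) fun _ => hspan).symm
    (IsPiSystem.pi fun _ => isPiSystem_Ioi) ?_ (by simp)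
  · rw [← borel_eq_generateFrom_Ioi, ← BorelSpace.measurable_eq]
  · rintro _ ⟨S, hS, rfl⟩
    choose s hs using fun i => hS i (Set.mem_univ i)
    obtain rfl : (fun i => Set.Ioi (s i)) = S := funext hs
    obtain ⟨i, hi⟩ := Finite.exists_min fun i => μ i (Set.Ioi (s i))
    rw [h.measure_pi_Ioi hco s hi, h'.measure_pi_Ioi hco' s hi]

lemma IsOptimalTransport.unique (h : IsOptimalTransport c μ γ) (h' : IsOptimalTransport c μ γ')
    (hc : ∀ i j, i < j → 0 ≤ c i j) (hconn : (costGraph c).Connected)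
    [∀ i, IsProbabilityMeasure (μ i)] (hμ : ∀ i, MemLp (fun x : ℝ => x) 2 (μ i))
    (hatom : ∀ i x, μ i {x} = 0) : γ = γ' :=
  have := hconn.nonempty
  h.1.eq_of_aeComonotone h'.1 (h.aeComonotone hc hconn hμ hatom)
    (h'.aeComonotone hc hconn hμ hatom)

end Uniqueness

end CovMMOT

theorem theorem5p3 {d : ℕ} (c : Fin d → Fin d → ℝ) (hc : ∀ i j, i < j → 0 ≤ c i j)
    (hconn : (CovMMOT.costGraph c).Connected)
    (μ ν : Fin d → Measure ℝ)
    [∀ i, IsProbabilityMeasure (μ i)] [∀ i, IsProbabilityMeasure (ν i)]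
    (hμ : ∀ i, MemLp (fun x : ℝ => x) 2 (μ i)) (hν : ∀ i, MemLp (fun x : ℝ => x) 2 (ν i))
    (a : Fin d → ℝ) (hLIM : CovMMOT.LIM μ ν a) :
    (∀ π : Measure ((Fin d → ℝ) × (Fin d → ℝ)), CovMMOT.IsMMOT c μ ν π →
      (∀ K : Kernel (Fin d → ℝ) (Fin d → ℝ), IsMarkovKernel K → π = π.fst.compProd K →
        ∀ᵐ x ∂π.fst, (K x).support ⊆ {y | y - x ∈ Submodule.span ℝ {a}}) ∧
      CovMMOT.IsOptimalTransport c μ π.fst) ∧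
    ((d = 2 ∨ d = 3) → (∀ i x, μ i {x} = 0) →
      ∀ π π' : Measure ((Fin d → ℝ) × (Fin d → ℝ)),
        CovMMOT.IsMMOT c μ ν π → CovMMOT.IsMMOT c μ ν π' → π.fst = π'.fst) := by
  refine ⟨fun π h => ⟨fun K _ hK => h.support_subset hc hconn hμ hν hLIM K hK,
    h.isOptimalTransport_fst hc hμ hν hLIM⟩, fun _ hatom π π' h h' => ?_⟩
  exact (h.isOptimalTransport_fst hc hμ hν hLIM).unique
    (h'.isOptimalTransport_fst hc hμ hν hLIM) hc hconn hμ hatom
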